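/- **Theorem 3.2.** Let $H_1,H_2$ be real Hilbert spaces (possibly infinite dimensional), let $L:H_1\to H_2$ be a bounded linear operator with adjoint $L^*$, let $g:H_1\to\mathbb R\cup\{\infty\}$ and $f:H_2\to\mathbb R\cup\{\infty\}$ be proper, convex and lower semicontinuous, and let $\lambda>0$. Write $F^*(y)=\sup_x(\langle x,y\rangle-F(x))$ for the Fenchel conjugate, $\partial F$ for the subdifferential and $\operatorname{dom}F=\{F<\infty\}$. Consider the primal and dual problems $$(P)\quad \min_{u\in H_1}\{g(u)+f(Lu)\},\qquad (D)\quad -\min_{b\in H_2}\{g^*(-L^*b)+f^*(b)\}.$$ Assume that 1. at least one of the following regularity conditions holds: there is $x\in\operatorname{dom}(g)\cap\operatorname{dom}(f\circ L)$ such that $f$ is continuous at $Lx$; or $0\in\operatorname{int}(L\operatorname{dom}(g)-\operatorname{dom}(f))$; 2. both $(P)$ and $(D)$ have optimal solutions; 3. $\partial(g^*\circ(-L^*))(b)=-L\,\partial g^*(-L^*b)$ for all $b\in H_2$. Let $(\alpha_k)_{k\ge1}$, $(\beta_k)_{k\ge1}$ be real sequences with $\sum_{k=1}^\infty(\alpha_k+\beta_k)<\infty$,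 and let $(u^k)_{k\ge1}$, $(d^k)_{k\ge0}$, $(b^k)_{k\ge0}$ be generated by the approximate alternating split Bregman algorithm, assumed to be well defined: $b^0,d^0\in H_2$ are arbitrary and for every $k\ge1$ * $\|Lu^k-Lu^k_{ex}\|\le\alpha_k$ for some minimizer $u^k_{ex}$ of $u\mapsto g(u)+\frac\lambda2\|b^{k-1}+Lu-d^{k-1}\|^2$ on $H_1$; * $\|d^k-d^k_{ex}\|\le\beta_k$, where $d^k_{ex}$ is the minimizer of $d\mapsto f(d)+\frac\lambda2\|b^{k-1}+Lu^k-d\|^2$ on $H_2$; * $b^k=b^{k-1}+Lu^k-d^k$. Then $(d^k)$ and $(b^k)$ converge weakly to some $\hat d$ and $\hat b$ in $H_2$, respectively. Moreover $\lambda\hat b$ is a solution of $(D)$, the sequence $(d^k-Lu^{k+1})_{k\ge 0}$ converges strongly to zero, and $$\sum_{k=0}^\infty\|d^k-Lu^{k+1}\|^2<\infty.$$ Furthermore, $L^{-1}(\hat d)$ contains a solution $\hat u$ of $(P)$. In particular, if $L$ is injective, then $(u^k)$ has at most one weak cluster point, and any weak cluster point $\bar u$ equals $\hat u$. -/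

import Mathlib

open Filter Topology
open scoped Pointwise

noncomputable section

namespace SplitBregman

section General

variable {H : Type*} [NormedAddCommGroup H] [InnerProductSpace ℝ H]

/-- The effective domain of a function with values in `ℝ ∪ {∞}`. -/
def effDom (F : H → EReal) : Set H := {x | F x < ⊤}

/-- Proper, convex (convex epigraph) and lower semicontinuous functions `H → ℝ ∪ {∞}`. -/
structure ProperConvexLsc (F : H → EReal) : Prop where
  ne_bot : ∀ x, F x ≠ ⊥
  dom_nonempty : (effDom F).Nonempty
  convex_epigraph : Convex ℝ {p : H × ℝ | F p.1 ≤ (p.2 : EReal)}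
  lsc : LowerSemicontinuous F

/-- The Fenchel conjugate `F^*(y) = sup_x (⟨x, y⟩ - F x)`. -/
def conj (F : H → EReal) (y : H) : EReal := ⨆ x, (((inner ℝ x y : ℝ) : EReal) - F x)

/-- The subdifferential `∂F(x)`; it is empty where `F` is not finite. -/
def subdiff (F : H → EReal) (x : H) : Set H :=
  {y | F x ≠ ⊥ ∧ F x ≠ ⊤ ∧ ∀ z, F x + ((inner ℝ y (z - x) : ℝ) : EReal) ≤ F z}

/-- Weak convergence of a sequence. -/
def WeakTendsto (x : ℕ → H) (a : H) : Prop :=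
  Tendsto (fun k => toWeakSpace ℝ H (x k)) atTop (𝓝 (toWeakSpace ℝ H a))

/-- `a` is a cluster point of the sequence `x` in the weak topology. -/
def WeakClusterPt (x : ℕ → H) (a : H) : Prop :=
  MapClusterPt (toWeakSpace ℝ H a) atTop (fun k => toWeakSpace ℝ H (x k))

end General

section Problem

variable {H₁ H₂ : Type*}
  [NormedAddCommGroup H₁] [InnerProductSpace ℝ H₁] [CompleteSpace H₁]
  [NormedAddCommGroup H₂] [InnerProductSpace ℝ H₂] [CompleteSpace H₂]

/-- `u` solves the primal problem `min_u g(u) + f(L u)`. -/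
def IsPrimalSolution (g : H₁ → EReal) (f : H₂ → EReal) (L : H₁ →L[ℝ] H₂) (u : H₁) : Prop :=
  IsMinOn (fun v => g v + f (L v)) Set.univ u

/-- The function `g^* ∘ (-L^*)` on `H₂`. -/
def conjNegAdjoint (g : H₁ → EReal) (L : H₁ →L[ℝ] H₂) (b : H₂) : EReal :=
  conj g (-(ContinuousLinearMap.adjoint L b))

/-- `b` solves the dual problem `-min_b (g^*(-L^* b) + f^*(b))`. -/
def IsDualSolution (g : H₁ → EReal) (f : H₂ → EReal) (L : H₁ →L[ℝ] H₂) (b : H₂) : Prop :=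
  IsMinOn (fun c => conjNegAdjoint g L c + conj f c) Set.univ b

/-- The regularity condition on `(g, f, L)`: `f` is continuous at `L x` for some
`x ∈ dom g ∩ dom (f ∘ L)`, or `0` is an interior point of `L (dom g) - dom f`. -/
def RegularityCondition (g : H₁ → EReal) (f : H₂ → EReal) (L : H₁ →L[ℝ] H₂) : Prop :=
  (∃ x, x ∈ effDom g ∧ L x ∈ effDom f ∧ ContinuousAt f (L x)) ∨
    (0 : H₂) ∈ interior (L '' effDom g - effDom f)

/-- The chain rule `∂(g^* ∘ (-L^*))(b) = -L ∂g^*(-L^* b)` for all `b`. -/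
def SubdiffChainRule (g : H₁ → EReal) (L : H₁ →L[ℝ] H₂) : Prop :=
  ∀ b : H₂, subdiff (conjNegAdjoint g L) b =
    -(L '' subdiff (conj g) (-(ContinuousLinearMap.adjoint L b)))

/-- The functional `u ↦ g(u) + (lam / 2) ‖b + L u - d‖²`. -/
def functional₁ (g : H₁ → EReal) (L : H₁ →L[ℝ] H₂) (lam : ℝ) (b d : H₂) (u : H₁) : EReal :=
  g u + ((lam / 2 * ‖b + L u - d‖ ^ 2 : ℝ) : EReal)

/-- The functional `d ↦ f(d) + (lam / 2) ‖b + L u - d‖²`. -/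
def functional₂ (f : H₂ → EReal) (L : H₁ →L[ℝ] H₂) (lam : ℝ) (b : H₂) (u : H₁) (d : H₂) :
    EReal :=
  f d + ((lam / 2 * ‖b + L u - d‖ ^ 2 : ℝ) : EReal)

/-- The sequences `u, d, b` are generated by the approximate alternating split Bregman
algorithm with error bounds `α, β`, started at `b 0, d 0`. Step `k + 1` uses exact minimizers
`uex, dex`, so their existence (the algorithm is well defined) is part of the predicate.
The value `u 0` plays no role. -/
structure IsApproxSplitBregman (g : H₁ → EReal) (f : H₂ → EReal) (L : H₁ →L[ℝ] H₂) (lam : ℝ)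
    (α β : ℕ → ℝ) (u : ℕ → H₁) (d b : ℕ → H₂) : Prop where
  step_u : ∀ k, ∃ uex, IsMinOn (functional₁ g L lam (b k) (d k)) Set.univ uex ∧
    ‖L (u (k + 1)) - L uex‖ ≤ α (k + 1)
  step_d : ∀ k, ∃ dex, IsMinOn (functional₂ f L lam (b k) (u (k + 1))) Set.univ dex ∧
    ‖d (k + 1) - dex‖ ≤ β (k + 1)
  step_b : ∀ k, b (k + 1) = b k + L (u (k + 1)) - d (k + 1)

end Problem

end SplitBregman

end

/-! The iteration is an inexact Douglas–Rachford iteration for the dual problem, with state (b, d)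
in the Hilbert product H₂ × H₂. Its two minimizations place λ(b + L uex - d) and λ(b + L u - dex) in
the optimality relations of g and f. Comparing them with a KKT point by monotonicity of both
subdifferentials shows that the distance to that point does not grow, up to 2(α + β), and that the
residuals are square summable (`norm_sq_step_le`, `quasiFejer`). By Opial's lemma it remains to see
that weak cluster points of (b, d) are scaled KKT points.

The u-iterates may be unbounded, so the limit is taken in the graphs of ∂f and ∂(g* ∘ (-L*)). The
residuals vanish strongly, hence the two duality pairings have opposite limits, and two
semicontinuity inequalities become equalities (`mem_subdiff_of_weakLim_of_sub_tendsto_zero`). The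
chain rule then recovers a primal point over the limit of d.

A KKT point to compare with comes from a primal solution by separation
(`IsPrimalSolution.exists_isKKTPair`): regularity makes the hyperplane nonvertical, and Baire's
theorem provides the interior that separation needs in infinite dimensions. -/

namespace SplitBregman

/-! ### Weak limits along filters and Opial's lemma -/

section WeakLimits

variable {ι H H' : Type*} [NormedAddCommGroup H] [InnerProductSpace ℝ H]
  [NormedAddCommGroup H'] [InnerProductSpace ℝ H']

/-- Weak convergence of a family along a filter, tested against inner products. -/
def WeakLim (l : Filter ι) (x : ι → H) (a : H) : Prop :=
  ∀ v, Tendsto (fun k => inner ℝ (x k) v) l (𝓝 (inner ℝ a v))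

lemma WeakLim.tendsto_apply [CompleteSpace H] {l : Filter ι} {x : ι → H} {a : H}
    (h : WeakLim l x a) (φ : H →L[ℝ] ℝ) : Tendsto (fun k => φ (x k)) l (𝓝 (φ a)) := by
  have hφ : ∀ z, inner ℝ z ((InnerProductSpace.toDual ℝ H).symm φ) = φ z := fun z => by
    rw [real_inner_comm, InnerProductSpace.toDual_symm_apply]
  simpa only [hφ] using h ((InnerProductSpace.toDual ℝ H).symm φ)

lemma tendsto_toWeakSpace_iff [CompleteSpace H] {l : Filter ι} {x : ι → H} {a : H} :
    Tendsto (fun k => toWeakSpace ℝ H (x k)) l (𝓝 (toWeakSpace ℝ H a)) ↔ WeakLim l x a := by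
  have hinj : Function.Injective (topDualPairing ℝ H).flip := by
    intro y z hyz
    refine ext_inner_left ℝ fun v => ?_
    exact DFunLike.congr_fun hyz (InnerProductSpace.toDual ℝ H v)
  have h := WeakBilin.tendsto_iff_forall_eval_tendsto (l := l) (topDualPairing ℝ H).flip
    (f := fun k => toWeakSpace ℝ H (x k)) (x := toWeakSpace ℝ H a) hinj
  refine h.trans ⟨fun h v => ?_, fun h φ => h.tendsto_apply φ⟩
  have h1 : Tendsto (fun k => inner ℝ v (x k)) l (𝓝 (inner ℝ v a)) :=
    h (InnerProductSpace.toDual ℝ H v)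
  simpa only [real_inner_comm v] using h1

lemma WeakLim.unique {l : Filter ι} [l.NeBot] {x : ι → H} {a a' : H} (h : WeakLim l x a)
    (h' : WeakLim l x a') : a = a' :=
  ext_inner_right ℝ fun v => tendsto_nhds_unique (h v) (h' v)

lemma WeakLim.mono {l l' : Filter ι} {x : ι → H} {a : H} (h : WeakLim l x a) (hl : l' ≤ l) :
    WeakLim l' x a := fun v => (h v).mono_left hl

lemma WeakLim.add {l : Filter ι} {x y : ι → H} {a a' : H} (h : WeakLim l x a)
    (h' : WeakLim l y a') : WeakLim l (fun k => x k + y k) (a + a') := fun v => by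
  simpa only [inner_add_left] using (h v).add (h' v)

lemma WeakLim.const_smul {l : Filter ι} {x : ι → H} {a : H} (h : WeakLim l x a) (c : ℝ) :
    WeakLim l (fun k => c • x k) (c • a) := fun v => by
  simpa only [real_inner_smul_left] using (h v).const_mul c

lemma WeakLim.neg {l : Filter ι} {x : ι → H} {a : H} (h : WeakLim l x a) :
    WeakLim l (fun k => -x k) (-a) := fun v => by
  simpa only [inner_neg_left] using (h v).neg

lemma weakLim_of_tendsto {l : Filter ι} {x : ι → H} {a : H} (h : Tendsto x l (𝓝 a)) :
    WeakLim l x a := fun _ => h.inner tendsto_const_nhds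

lemma WeakLim.of_sub_tendsto_zero {l : Filter ι} {x y : ι → H} {a : H} (h : WeakLim l x a)
    (h' : Tendsto (fun k => y k - x k) l (𝓝 0)) : WeakLim l y a := by
  simpa using h.add (weakLim_of_tendsto h')

lemma WeakLim.map [CompleteSpace H] [CompleteSpace H'] {l : Filter ι} {x : ι → H} {a : H}
    (h : WeakLim l x a) (L : H →L[ℝ] H') : WeakLim l (fun k => L (x k)) (L a) := fun v => by
  simpa only [ContinuousLinearMap.adjoint_inner_right] using h (ContinuousLinearMap.adjoint L v)

/-- Banach–Alaoglu transported by the Riesz isometry. Ultrafilters replace subsequences, so no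
separability is needed. -/
lemma exists_weakLim_of_bounded [CompleteSpace H] (U : Ultrafilter ι) {x : ι → H} {C : ℝ}
    (hx : ∀ k, ‖x k‖ ≤ C) : ∃ a, WeakLim (U : Filter ι) x a := by
  let T : ι → WeakDual ℝ H := fun k =>
    StrongDual.toWeakDual (InnerProductSpace.toDual ℝ H (x k))
  obtain ⟨φ, -, hφ⟩ := (WeakDual.isCompact_closedBall (𝕜 := ℝ) (E := H) 0 C).ultrafilter_le_nhds
    (U.map T) (by
      rw [le_principal_iff, Ultrafilter.mem_coe, Ultrafilter.mem_map]
      refine Filter.univ_mem' fun k => ?_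
      simp only [Set.mem_preimage, mem_closedBall_zero_iff]
      exact ((InnerProductSpace.toDual ℝ H).norm_map (x k)).le.trans (hx k))
  refine ⟨(InnerProductSpace.toDual ℝ H).symm (WeakDual.toStrongDual φ), fun v => ?_⟩
  rw [InnerProductSpace.toDual_symm_apply]
  exact ((WeakDual.eval_continuous v).tendsto φ).comp hφ

/-- A point outside would be strictly separated by a continuous functional, which passes to the weak
limit. -/
lemma WeakLim.mem_of_isClosed [CompleteSpace H] {l : Filter ι} [l.NeBot] {x : ι → H} {a : H}
    (h : WeakLim l x a) {s : Set H} (hc : Convex ℝ s) (hs : IsClosed s)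
    (hx : ∀ᶠ k in l, x k ∈ s) : a ∈ s := by
  by_contra ha
  obtain ⟨φ, r, hr, hra⟩ := geometric_hahn_banach_closed_point hc hs ha
  have h2 : φ a ≤ r := le_of_tendsto (h.tendsto_apply φ) (hx.mono fun k hk => (hr _ hk).le)
  exact absurd hra h2.not_gt

lemma tendsto_inner_sub_inner_zero {l : Filter ι} {x x' y y' : ι → H} {C : ℝ}
    (hx : Tendsto (fun k => x' k - x k) l (𝓝 0)) (hy : Tendsto (fun k => y' k - y k) l (𝓝 0))
    (hxC : ∀ k, ‖x k‖ ≤ C) (hyC : ∀ k, ‖y k‖ ≤ C) :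
    Tendsto (fun k => inner ℝ (x' k) (y' k) - inner ℝ (x k) (y k)) l (𝓝 0) := by
  have hb : Tendsto (fun k => ‖x' k - x k‖ * ‖y' k - y k‖ + ‖x' k - x k‖ * C +
      C * ‖y' k - y k‖) l (𝓝 0) := by
    simpa using ((hx.norm.mul hy.norm).add (hx.norm.mul_const C)).add (hy.norm.const_mul C)
  refine squeeze_zero_norm (fun k => ?_) hb
  have : inner ℝ (x' k) (y' k) - inner ℝ (x k) (y k) = inner ℝ (x' k - x k) (y' k - y k) +
      inner ℝ (x' k - x k) (y k) + inner ℝ (x k) (y' k - y k) := by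
    simp only [inner_sub_left, inner_sub_right]; ring
  rw [this]
  refine norm_add₃_le.trans (add_le_add_three (norm_inner_le_norm _ _) ?_ ?_)
  · exact (norm_inner_le_norm _ _).trans (by gcongr; exact hyC k)
  · exact (norm_inner_le_norm _ _).trans (by gcongr; exact hxC k)

/-- Opial's lemma: if the distances to all points of `S` converge and all weak cluster points
belong to `S`, then the sequence converges weakly to a point of `S`. -/
lemma exists_weakLim_of_tendsto_norm_sub [CompleteSpace H] {x : ℕ → H} {S : Set H}
    (hbdd : ∃ C, ∀ k, ‖x k‖ ≤ C)
    (hdist : ∀ s ∈ S, ∃ r, Tendsto (fun k => ‖x k - s‖) atTop (𝓝 r))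
    (hclus : ∀ (U : Ultrafilter ℕ) (a : H), (U : Filter ℕ) ≤ atTop →
      WeakLim (U : Filter ℕ) x a → a ∈ S) :
    ∃ a ∈ S, WeakLim atTop x a := by
  obtain ⟨C, hC⟩ := hbdd
  have huniq : ∀ (U V : Ultrafilter ℕ) (a a' : H), (U : Filter ℕ) ≤ atTop →
      (V : Filter ℕ) ≤ atTop → WeakLim (U : Filter ℕ) x a → WeakLim (V : Filter ℕ) x a' →
      a = a' := by
    intro U V a a' hU hV ha ha'
    obtain ⟨r, hr⟩ := hdist a (hclus U a hU ha)
    obtain ⟨r', hr'⟩ := hdist a' (hclus V a' hV ha')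
    -- The difference of the two squared distances is affine in `x k`, so this pairing converges
    -- along the whole sequence; both cluster points must then give it the same value.
    have hconv : Tendsto (fun k => inner ℝ (x k) (a - a')) atTop
        (𝓝 ((r' ^ 2 - r ^ 2 + (‖a‖ ^ 2 - ‖a'‖ ^ 2)) / 2)) := by
      refine ((((hr'.pow 2).sub (hr.pow 2)).add_const (‖a‖ ^ 2 - ‖a'‖ ^ 2)).div_const 2).congr
        fun k => ?_
      rw [norm_sub_sq_real, norm_sub_sq_real, inner_sub_right]; ring
    have h1 := tendsto_nhds_unique (ha (a - a')) (hconv.mono_left hU)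
    have h2 := tendsto_nhds_unique (ha' (a - a')) (hconv.mono_left hV)
    have h3 : inner ℝ (a - a') (a - a') = 0 := by rw [inner_sub_left, h1, h2, sub_self]
    exact sub_eq_zero.1 (inner_self_eq_zero.1 h3)
  obtain ⟨a, ha⟩ := exists_weakLim_of_bounded (Ultrafilter.of atTop) hC
  refine ⟨a, hclus _ a (Ultrafilter.of_le _) ha, fun v => ?_⟩
  rw [tendsto_iff_ultrafilter]
  intro V hV
  obtain ⟨a', ha'⟩ := exists_weakLim_of_bounded V hC
  rw [huniq _ V a a' (Ultrafilter.of_le _) hV ha ha']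
  exact ha' v

end WeakLimits

/-! ### Quasi-Fejér sequences -/

section QuasiFejer

/-- A nonnegative sequence that increases by summable amounts converges. -/
lemma exists_tendsto_of_le_add_summable {N ε : ℕ → ℝ} (hN : ∀ k, 0 ≤ N k) (hε : Summable ε)
    (hε0 : ∀ k, 0 ≤ ε k) (h : ∀ k, N (k + 1) ≤ N k + ε k) :
    ∃ r, Tendsto N atTop (𝓝 r) := by
  have hanti : Antitone fun k => N k - ∑ i ∈ Finset.range k, ε i := by
    refine antitone_nat_of_succ_le fun k => ?_
    rw [Finset.sum_range_succ]
    linarith [h k]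
  have hbdd : BddBelow (Set.range fun k => N k - ∑ i ∈ Finset.range k, ε i) := by
    refine ⟨-∑' i, ε i, ?_⟩
    rintro _ ⟨k, rfl⟩
    have := hε.sum_le_tsum (Finset.range k) fun i _ => hε0 i
    simp only
    linarith [hN k]
  refine ⟨_, ((tendsto_atTop_ciInf hanti hbdd).add hε.hasSum.tendsto_sum_nat).congr fun k => ?_⟩
  ring

lemma summable_of_add_le_add_summable {N r ε : ℕ → ℝ} (hN : ∀ k, 0 ≤ N k) (hr : ∀ k, 0 ≤ r k)
    (hε : Summable ε) (hε0 : ∀ k, 0 ≤ ε k) (h : ∀ k, N (k + 1) + r k ≤ N k + ε k) :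
    Summable r := by
  refine summable_of_sum_range_le (c := N 0 + ∑' i, ε i) hr fun n => ?_
  have key : ∀ n, N n + ∑ i ∈ Finset.range n, r i ≤ N 0 + ∑ i ∈ Finset.range n, ε i := by
    intro n
    induction n with
    | zero => simp
    | succ n ih =>
      rw [Finset.sum_range_succ, Finset.sum_range_succ]
      linarith [h n]
  linarith [key n, hN n, hε.sum_le_tsum (Finset.range n) fun i _ => hε0 i]

/-- A quasi-Fejér estimate: the distances `N` converge and the residuals `r` are square
summable. -/
lemma quasiFejer {N r ε : ℕ → ℝ} (hN : ∀ k, 0 ≤ N k) (hε : Summable ε) (hε0 : ∀ k, 0 ≤ ε k)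
    (h : ∀ k, N (k + 1) ^ 2 + r k ^ 2 ≤ (N k + ε k) ^ 2) :
    (∃ a, Tendsto N atTop (𝓝 a)) ∧ Summable fun k => r k ^ 2 := by
  have hlim : ∃ a, Tendsto N atTop (𝓝 a) := by
    refine exists_tendsto_of_le_add_summable hN hε hε0 fun k => ?_
    refine le_of_sq_le_sq ?_ (add_nonneg (hN k) (hε0 k))
    linarith [h k, sq_nonneg (r k)]
  refine ⟨hlim, ?_⟩
  obtain ⟨C, hC⟩ := hlim.choose_spec.bddAbove_range
  have hC' : ∀ k, N k ≤ C := fun k => hC ⟨k, rfl⟩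
  have hT : ∀ k, ε k ≤ ∑' i, ε i := fun k => hε.le_tsum k fun i _ => hε0 i
  -- Expanding the square leaves the error ε(2N + ε), bounded by ε times a constant.
  refine summable_of_add_le_add_summable (N := fun k => N k ^ 2)
    (ε := fun k => ε k * (2 * C + ∑' i, ε i)) (fun k => sq_nonneg _) (fun k => sq_nonneg _)
    (hε.mul_right _) (fun k => mul_nonneg (hε0 k) ?_) fun k => ?_
  · linarith [hN k, hC' k, hε0 k, hT k]
  · nlinarith [h k, mul_le_mul_of_nonneg_left (hC' k) (hε0 k),
      mul_le_mul_of_nonneg_left (hT k) (hε0 k)]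

end QuasiFejer

/-! ### Subdifferentials of convex functions -/

section Subdifferential

variable {ι H H' : Type*} [NormedAddCommGroup H] [InnerProductSpace ℝ H]
  [NormedAddCommGroup H'] [InnerProductSpace ℝ H']

/-- Quantifying over real upper bounds `c` of `F z` keeps the inequality in ℝ and makes points of
value ∞ vacuous. -/
lemma mem_subdiff_iff {F : H → EReal} {x y : H} :
    y ∈ subdiff F x ↔ ∃ a : ℝ, F x = a ∧
      ∀ z (c : ℝ), F z ≤ c → a + inner ℝ y (z - x) ≤ c := by
  constructor
  · rintro ⟨h1, h2, h3⟩
    refine ⟨(F x).toReal, (EReal.coe_toReal h2 h1).symm, fun z c hc => ?_⟩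
    have := (h3 z).trans hc
    rw [← EReal.coe_toReal h2 h1] at this
    exact_mod_cast this
  · rintro ⟨a, ha, h⟩
    refine ⟨by simp [ha], by simp [ha], fun z => ?_⟩
    rw [ha]
    refine EReal.le_of_forall_lt_iff_le.1 fun c hc => ?_
    exact_mod_cast h z c hc.le

lemma inner_sub_sub_nonneg_of_mem_subdiff {F : H → EReal} {x x' y y' : H}
    (h : y ∈ subdiff F x) (h' : y' ∈ subdiff F x') : 0 ≤ inner ℝ (y - y') (x - x') := by
  obtain ⟨a, ha, h⟩ := mem_subdiff_iff.1 h
  obtain ⟨a', ha', h'⟩ := mem_subdiff_iff.1 h'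
  have h1 := h x' a' ha'.le
  have h2 := h' x a ha.le
  rw [← neg_sub, inner_neg_right] at h1
  rw [inner_sub_left]
  linarith

lemma ProperConvexLsc.convex_sublevel {F : H → EReal} (hF : ProperConvexLsc F) (r : ℝ) :
    Convex ℝ {x | F x ≤ r} := by
  intro x hx y hy s t hs ht hst
  have := @hF.convex_epigraph (x, r) hx (y, r) hy s t hs ht hst
  simp only [Set.mem_ofPred_eq, Prod.fst_add, Prod.snd_add, Prod.smul_fst, Prod.smul_snd,
    smul_eq_mul, ← add_mul, hst, one_mul] at this
  exact this

lemma ProperConvexLsc.isClosed_sublevel {F : H → EReal} (hF : ProperConvexLsc F) (r : ℝ) :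
    IsClosed {x | F x ≤ r} := hF.lsc.isClosed_preimage r

lemma ProperConvexLsc.exists_real {F : H → EReal} (hF : ProperConvexLsc F) {x : H}
    (hx : F x < ⊤) : ∃ a : ℝ, F x = a :=
  ⟨(F x).toReal, (EReal.coe_toReal hx.ne (hF.ne_bot x)).symm⟩

/-- First order optimality condition for the sum of a convex function and a quadratic. -/
lemma mem_subdiff_of_isMinOn_add_norm_sq {F : H → EReal} (hF : ProperConvexLsc F)
    {lam : ℝ} (M : H →L[ℝ] H') (c : H') {x y : H}
    (hmin : IsMinOn (fun z => F z + ((lam / 2 * ‖c + M z‖ ^ 2 : ℝ) : EReal)) Set.univ x)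
    (hy : ∀ z, inner ℝ y z = -(lam * inner ℝ (c + M x) (M z))) : y ∈ subdiff F x := by
  have hmin' := fun z => isMinOn_iff.1 hmin z (Set.mem_univ z)
  obtain ⟨x₀, hx₀⟩ := hF.dom_nonempty
  obtain ⟨a₀, ha₀⟩ := hF.exists_real hx₀
  have hx : F x < ⊤ := by
    by_contra hx
    have h := hmin' x₀
    rw [not_lt_top_iff.1 hx, ha₀, EReal.top_add_coe, ← EReal.coe_add] at h
    exact absurd h (not_le.2 (EReal.coe_lt_top _))
  obtain ⟨a, ha⟩ := hF.exists_real hx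
  refine mem_subdiff_iff.2 ⟨a, ha, fun z r hr => ?_⟩
  -- Minimality is tested on the segment from `x` to `z`; after convexity and division by `t`, only
  -- the last term depends on `t`, and it vanishes as `t` tends to 0.
  have hlin : ∀ t : ℝ, 0 < t → t < 1 →
      0 ≤ (r - a + lam * inner ℝ (c + M x) (M (z - x))) + t * (lam / 2 * ‖M (z - x)‖ ^ 2) := by
    intro t ht ht1
    have hcv := @hF.convex_epigraph (x, a) ha.le (z, r) hr (1 - t) t (by linarith) ht.le (by ring)
    have hpt : (1 - t) • x + t • z = x + t • (z - x) := by
      rw [sub_smul, one_smul, smul_sub]; abel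
    simp only [Set.mem_ofPred_eq, Prod.fst_add, Prod.snd_add, Prod.smul_fst, Prod.smul_snd,
      smul_eq_mul, hpt] at hcv
    have h := (hmin' (x + t • (z - x))).trans (add_le_add_left hcv _)
    rw [ha] at h
    have h' : a + lam / 2 * ‖c + M x‖ ^ 2 ≤
        (1 - t) * a + t * r + lam / 2 * ‖c + M (x + t • (z - x))‖ ^ 2 := by exact_mod_cast h
    have hM : c + M (x + t • (z - x)) = (c + M x) + t • M (z - x) := by
      rw [map_add, map_smul]; abel
    rw [hM, norm_add_sq_real (c + M x), real_inner_smul_right, norm_smul, mul_pow, Real.norm_eq_abs,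
      sq_abs] at h'
    refine nonneg_of_mul_nonneg_right (?_ : 0 ≤ t * _) ht
    nlinarith
  have hlim : Tendsto (fun t : ℝ => (r - a + lam * inner ℝ (c + M x) (M (z - x))) +
      t * (lam / 2 * ‖M (z - x)‖ ^ 2)) (𝓝[>] 0)
      (𝓝 ((r - a + lam * inner ℝ (c + M x) (M (z - x))) + 0 * (lam / 2 * ‖M (z - x)‖ ^ 2))) :=
    ((continuous_const.add (continuous_id.mul continuous_const)).tendsto 0).mono_left
      nhdsWithin_le_nhds
  have := ge_of_tendsto hlim (by
    filter_upwards [Ioo_mem_nhdsGT (zero_lt_one' ℝ)] with t ht using hlin t ht.1 ht.2)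
  rw [hy]
  linarith

/-- Weak limits of points in the graph of a subdifferential along which the duality pairing
converges. -/
lemma WeakLim.subdiff_limit [CompleteSpace H] {F : H → EReal} (hF : ProperConvexLsc F)
    {l : Filter ι} [l.NeBot] {x y : ι → H} {a p : H} {r : ℝ} (hx : WeakLim l x a)
    (hy : WeakLim l y p) (hr : Tendsto (fun k => inner ℝ (y k) (x k)) l (𝓝 r))
    (h : ∀ k, y k ∈ subdiff F (x k)) :
    inner ℝ p a ≤ r ∧ (r ≤ inner ℝ p a → p ∈ subdiff F a) := by
  -- The subgradient inequality bounds `F (x k)` by a convergent real sequence; closed convex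
  -- sublevel sets carry the bound to the weak limit.
  have key : ∀ z (c : ℝ), F z ≤ c → F a ≤ ((c - inner ℝ p z + r : ℝ) : EReal) := by
    intro z c hc
    refine EReal.le_of_forall_lt_iff_le.1 fun s hs => ?_
    have hs' : c - inner ℝ p z + r < s := by exact_mod_cast hs
    refine hx.mem_of_isClosed (hF.convex_sublevel s) (hF.isClosed_sublevel s) ?_
    have ht : Tendsto (fun k => c - inner ℝ (y k) z + inner ℝ (y k) (x k)) l
        (𝓝 (c - inner ℝ p z + r)) := (tendsto_const_nhds.sub (hy z)).add hr
    filter_upwards [ht.eventually_lt_const hs'] with k hk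
    obtain ⟨b, hb, hsub⟩ := mem_subdiff_iff.1 (h k)
    have := hsub z c hc
    rw [inner_sub_right] at this
    simp only [hb, EReal.coe_le_coe_iff]
    linarith
  obtain ⟨x₀, hx₀⟩ := hF.dom_nonempty
  obtain ⟨c₀, hc₀⟩ := hF.exists_real hx₀
  obtain ⟨s, hs⟩ := hF.exists_real ((key x₀ c₀ hc₀.le).trans_lt (EReal.coe_lt_top _))
  have key' : ∀ z (c : ℝ), F z ≤ c → s ≤ c - inner ℝ p z + r := by
    intro z c hc
    have := key z c hc
    rw [hs] at this
    exact_mod_cast this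
  -- The choice `z = a` bounds the limit pairing by `r`; the reverse bound turns `key'` into the
  -- subgradient inequality.
  refine ⟨by linarith [key' a s hs.le], fun hle => mem_subdiff_iff.2 ⟨s, hs, fun z c hc => ?_⟩⟩
  rw [inner_sub_right]
  linarith [key' z c hc]

end Subdifferential

/-! ### Fenchel conjugates -/

section Conjugate

variable {H : Type*} [NormedAddCommGroup H] [InnerProductSpace ℝ H]

lemma conj_le_coe_iff {F : H → EReal} (hF : ∀ x, F x ≠ ⊥) {y : H} {r : ℝ} :
    conj F y ≤ r ↔ ∀ x (c : ℝ), F x ≤ c → inner ℝ x y - c ≤ r := by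
  rw [conj, iSup_le_iff]
  refine forall_congr' fun x => ?_
  rcases eq_or_ne (F x) ⊤ with hx | hx
  · simp [hx]
  · rw [← EReal.coe_toReal hx (hF x)]
    constructor
    · intro h c hc
      have h' : inner ℝ x y - (F x).toReal ≤ r := by exact_mod_cast h
      have hc' : (F x).toReal ≤ c := by exact_mod_cast hc
      linarith
    · intro h
      exact_mod_cast h (F x).toReal le_rfl

lemma conj_ne_bot {F : H → EReal} (hF : ProperConvexLsc F) (y : H) : conj F y ≠ ⊥ := by
  obtain ⟨x, hx⟩ := hF.dom_nonempty
  obtain ⟨a, ha⟩ := hF.exists_real hx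
  refine ne_bot_of_le_ne_bot (b := ((inner ℝ x y - a : ℝ) : EReal)) (EReal.coe_ne_bot _) ?_
  rw [conj, EReal.coe_sub, ← ha]
  exact le_iSup (fun x => ((inner ℝ x y : ℝ) : EReal) - F x) x

lemma coe_le_conj {F : H → EReal} {x y : H} {a : ℝ} (ha : F x ≤ a) :
    ((inner ℝ x y - a : ℝ) : EReal) ≤ conj F y := by
  refine le_trans ?_ (le_iSup (fun x => ((inner ℝ x y : ℝ) : EReal) - F x) x)
  rw [EReal.coe_sub]
  exact EReal.sub_le_sub le_rfl ha

lemma conj_eq_of_mem_subdiff {F : H → EReal} (hF : ∀ x, F x ≠ ⊥) {x y : H} {a : ℝ}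
    (h : y ∈ subdiff F x) (ha : F x = a) : conj F y = ((inner ℝ x y - a : ℝ) : EReal) := by
  refine le_antisymm ((conj_le_coe_iff hF).2 fun z c hc => ?_) (coe_le_conj ha.le)
  obtain ⟨a', ha', h⟩ := mem_subdiff_iff.1 h
  obtain rfl : a = a' := by exact_mod_cast ha.symm.trans ha'
  have := h z c hc
  rw [inner_sub_right, real_inner_comm, real_inner_comm _ y] at this
  linarith

lemma lowerSemicontinuous_conj {F : H → EReal} (hF : ∀ x, F x ≠ ⊥) :
    LowerSemicontinuous (conj F) := by
  refine lowerSemicontinuous_iSup fun x => ?_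
  rcases eq_or_ne (F x) ⊤ with hx | hx
  · simp only [hx, EReal.sub_top]
    exact lowerSemicontinuous_const
  · rw [← EReal.coe_toReal hx (hF x)]
    simp only [← EReal.coe_sub]
    refine Continuous.lowerSemicontinuous (continuous_coe_real_ereal.comp ?_)
    fun_prop

lemma convex_epigraph_conj {F : H → EReal} (hF : ∀ x, F x ≠ ⊥) :
    Convex ℝ {p : H × ℝ | conj F p.1 ≤ (p.2 : EReal)} := by
  rintro ⟨y, r⟩ hy ⟨y', r'⟩ hy' s t hs ht hst
  simp only [Set.mem_ofPred_eq, Prod.fst_add, Prod.snd_add, Prod.smul_fst, Prod.smul_snd,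
    smul_eq_mul, conj_le_coe_iff hF] at hy hy' ⊢
  intro x c hc
  have h1 := mul_le_mul_of_nonneg_left (hy x c hc) hs
  have h2 := mul_le_mul_of_nonneg_left (hy' x c hc) ht
  rw [inner_add_right, real_inner_smul_right, real_inner_smul_right]
  have : c = s * c + t * c := by rw [← add_mul, hst, one_mul]
  linarith

/-- The subdifferential of a proper convex lower semicontinuous function contains the inverse
of the subdifferential of its conjugate. -/
lemma mem_subdiff_of_mem_subdiff_conj [CompleteSpace H] {F : H → EReal} (hF : ProperConvexLsc F)
    {x y : H} (h : x ∈ subdiff (conj F) y) : y ∈ subdiff F x := by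
  obtain ⟨q, hq, hsub⟩ := mem_subdiff_iff.1 h
  have hFq := (conj_le_coe_iff hF.ne_bot).1 hq.le
  -- This is the nontrivial half of Fenchel–Young equality. If it fails, the corresponding point
  -- lies off the closed convex epigraph and is separated from it.
  suffices hle : F x ≤ ((inner ℝ x y - q : ℝ) : EReal) by
    obtain ⟨a, ha⟩ := hF.exists_real (hle.trans_lt (EReal.coe_lt_top _))
    have ha' : a ≤ inner ℝ x y - q := by rw [ha] at hle; exact_mod_cast hle
    refine mem_subdiff_iff.2 ⟨a, ha, fun z c hc => ?_⟩
    have := hFq z c hc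
    rw [inner_sub_right, real_inner_comm, real_inner_comm _ y]
    linarith
  by_contra hlt
  have hclosed : IsClosed {p : H × ℝ | F p.1 ≤ (p.2 : EReal)} := by
    refine (hF.lsc.isClosed_epigraph).preimage (f := fun p : H × ℝ => (p.1, (p.2 : EReal))) ?_
    exact continuous_fst.prodMk (continuous_coe_real_ereal.comp continuous_snd)
  obtain ⟨φ, δ, h1, h2⟩ := geometric_hahn_banach_point_closed hF.convex_epigraph hclosed
    (show ((x, inner ℝ x y - q) : H × ℝ) ∉ {p : H × ℝ | F p.1 ≤ (p.2 : EReal)} from hlt)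
  set w : H := (InnerProductSpace.toDual ℝ H).symm (φ.comp (ContinuousLinearMap.inl ℝ H ℝ))
    with hw
  set s : ℝ := φ (0, 1) with hs
  have hφ : ∀ (z : H) (c : ℝ), φ (z, c) = inner ℝ z w + s * c := by
    intro z c
    have : ((z, c) : H × ℝ) = (z, 0) + c • ((0, 1) : H × ℝ) := by simp
    rw [this, map_add, map_smul, real_inner_comm, hw, InnerProductSpace.toDual_symm_apply]
    simp [hs, mul_comm]
  rw [hφ] at h1
  have h2' : ∀ z (c : ℝ), F z ≤ c → δ < inner ℝ z w + s * c := fun z c hc => by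
    rw [← hφ]; exact h2 (z, c) hc
  obtain ⟨x₀, hx₀⟩ := hF.dom_nonempty
  obtain ⟨a₀, ha₀⟩ := hF.exists_real hx₀
  have hs0 : 0 ≤ s := by
    by_contra hneg
    push Not at hneg
    set M : ℝ := |δ - inner ℝ x₀ w - s * a₀| / (-s) with hM
    have hM0 : 0 ≤ M := div_nonneg (abs_nonneg _) (by linarith)
    have h3 := h2' x₀ (a₀ + M) (ha₀.le.trans (by exact_mod_cast (by linarith)))
    have h4 : s * M = -|δ - inner ℝ x₀ w - s * a₀| := by
      rw [hM, div_neg, mul_neg, mul_div_cancel₀ _ hneg.ne]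
    have := neg_abs_le (δ - inner ℝ x₀ w - s * a₀)
    nlinarith
  -- Each kind of hyperplane yields a test slope violating the subgradient inequality of the
  -- conjugate at `y`: the vertical one gives `y - w`, the other its own slope `-w/s`.
  rcases hs0.eq_or_lt with hs0 | hs0
  · rw [← hs0] at h1 h2'
    have h3 : conj F (y - w) ≤ ((q - δ : ℝ) : EReal) := by
      refine (conj_le_coe_iff hF.ne_bot).2 fun z c hc => ?_
      have h4 := hFq z c hc
      have h5 := h2' z c hc
      rw [inner_sub_right]
      linarith
    have h4 := hsub _ _ h3
    simp only [sub_sub_cancel_left, inner_neg_right] at h4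
    linarith
  · have h3 : conj F (-(s⁻¹ • w)) ≤ ((-(s⁻¹ * δ) : ℝ) : EReal) := by
      refine (conj_le_coe_iff hF.ne_bot).2 fun z c hc => ?_
      have h5 := mul_lt_mul_of_pos_left (h2' z c hc) (inv_pos.2 hs0)
      rw [mul_add, inv_mul_cancel_left₀ hs0.ne'] at h5
      rw [inner_neg_right, real_inner_smul_right]
      linarith
    have h4 := hsub _ _ h3
    have h5 := mul_lt_mul_of_pos_left h1 (inv_pos.2 hs0)
    rw [mul_add, inv_mul_cancel_left₀ hs0.ne'] at h5
    rw [inner_sub_right, inner_neg_right, real_inner_smul_right] at h4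
    linarith

end Conjugate

/-! ### Perturbed primal values -/

section Perturbation

variable {H₁ H₂ : Type*} [NormedAddCommGroup H₁] [InnerProductSpace ℝ H₁]
  [NormedAddCommGroup H₂] [InnerProductSpace ℝ H₂]
  {g : H₁ → EReal} {f : H₂ → EReal} {L : H₁ →L[ℝ] H₂}

/-- Continuity keeps `f` finite near `L x`, so small shifts of `L x` stay in its domain and the
first regularity condition implies the second. -/
lemma RegularityCondition.zero_mem_interior (h : RegularityCondition g f L) :
    (0 : H₂) ∈ interior (L '' effDom g - effDom f) := by
  rcases h with ⟨x, hxg, hxf, hcont⟩ | h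
  · have h1 : ∀ᶠ w in 𝓝 (L x), f w < ⊤ := hcont.eventually_lt_const hxf
    have h2 : Tendsto (fun y => L x - y) (𝓝 0) (𝓝 (L x)) := by
      have : Continuous fun y : H₂ => L x - y := by fun_prop
      simpa using this.tendsto 0
    rw [mem_interior_iff_mem_nhds]
    filter_upwards [h2.eventually h1] with y hy
    exact ⟨L x, ⟨x, hxg, rfl⟩, L x - y, hy, sub_sub_cancel _ _⟩
  · exact h

/-- The epigraph of the perturbed primal value. -/
def perturbationEpigraph (g : H₁ → EReal) (f : H₂ → EReal) (L : H₁ →L[ℝ] H₂) : Set (H₂ × ℝ) :=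
  {p | ∃ u w, ∃ a c : ℝ, g u ≤ a ∧ f w ≤ c ∧ L u - w = p.1 ∧ a + c ≤ p.2}

lemma convex_perturbationEpigraph (hg : ProperConvexLsc g) (hf : ProperConvexLsc f) :
    Convex ℝ (perturbationEpigraph g f L) := by
  rintro ⟨y, r⟩ ⟨u, w, a, c, hu, hw, hy, hr⟩ ⟨y', r'⟩ ⟨u', w', a', c', hu', hw', hy', hr'⟩
    s t hs ht hst
  refine ⟨s • u + t • u', s • w + t • w', s • a + t • a', s • c + t • c',
    @hg.convex_epigraph (u, a) hu (u', a') hu' s t hs ht hst,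
    @hf.convex_epigraph (w, c) hw (w', c') hw' s t hs ht hst, ?_, ?_⟩
  · simp only at hy hy'
    simp only [← hy, ← hy', map_add, map_smul, Prod.fst_add, Prod.smul_fst, smul_sub]
    abel
  · simp only [smul_eq_mul, Prod.snd_add, Prod.smul_snd] at hr hr' ⊢
    nlinarith

end Perturbation

/-! ### KKT pairs and duality -/

section Duality

variable {H₁ H₂ : Type*}
  [NormedAddCommGroup H₁] [InnerProductSpace ℝ H₁] [CompleteSpace H₁]
  [NormedAddCommGroup H₂] [InnerProductSpace ℝ H₂] [CompleteSpace H₂]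
  {g : H₁ → EReal} {f : H₂ → EReal} {L : H₁ →L[ℝ] H₂}

/-- The Karush-Kuhn-Tucker conditions for a primal-dual pair. -/
def IsKKTPair (g : H₁ → EReal) (f : H₂ → EReal) (L : H₁ →L[ℝ] H₂) (u : H₁) (c : H₂) : Prop :=
  -(ContinuousLinearMap.adjoint L c) ∈ subdiff g u ∧ c ∈ subdiff f (L u)

/-- The set of perturbations reached by points of size and value at most `r`. -/
def boundedPerturbations (g : H₁ → EReal) (f : H₂ → EReal) (L : H₁ →L[ℝ] H₂) (r : ℝ) : Set H₂ :=
  {y | ∃ u w, ‖u‖ ≤ r ∧ ‖w‖ ≤ r ∧ g u ≤ r ∧ f w ≤ r ∧ L u - w = y}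

/-- The bounds give weak compactness of the representing points, and every constraint is weakly
closed. -/
lemma isClosed_boundedPerturbations (hg : ProperConvexLsc g) (hf : ProperConvexLsc f) (r : ℝ) :
    IsClosed (boundedPerturbations g f L r) := by
  refine isClosed_of_closure_subset fun y hy => ?_
  obtain ⟨s, hs, hlim⟩ := mem_closure_iff_seq_limit.1 hy
  choose u w hu hw hgu hfw hy' using hs
  obtain ⟨a, ha⟩ := exists_weakLim_of_bounded (Ultrafilter.of (atTop : Filter ℕ)) hu
  obtain ⟨c, hc⟩ := exists_weakLim_of_bounded (Ultrafilter.of (atTop : Filter ℕ)) hw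
  refine ⟨a, c, ?_, ?_, ?_, ?_, ?_⟩
  · simpa using ha.mem_of_isClosed (convex_closedBall (0 : H₁) r) Metric.isClosed_closedBall
      (Eventually.of_forall fun k => by simpa using hu k)
  · simpa using hc.mem_of_isClosed (convex_closedBall (0 : H₂) r) Metric.isClosed_closedBall
      (Eventually.of_forall fun k => by simpa using hw k)
  · exact ha.mem_of_isClosed (hg.convex_sublevel r) (hg.isClosed_sublevel r)
      (Eventually.of_forall hgu)
  · exact hc.mem_of_isClosed (hf.convex_sublevel r) (hf.isClosed_sublevel r)
      (Eventually.of_forall hfw)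
  · have h1 : WeakLim (Ultrafilter.of (atTop : Filter ℕ) : Filter ℕ) s (L a + -c) := by
      have := (ha.map L).add hc.neg
      simpa only [← sub_eq_add_neg, hy'] using this
    rw [sub_eq_add_neg]
    exact h1.unique (weakLim_of_tendsto (hlim.mono_left (Ultrafilter.of_le _)))

/-- Baire's theorem: the closed sets of bounded perturbations cover the open set `V`. Adjoining `Vᶜ`
makes the cover global, and the interior point is then sought inside `V`. -/
lemma exists_interior_boundedPerturbations_nonempty (hg : ProperConvexLsc g)
    (hf : ProperConvexLsc f) (h0 : (0 : H₂) ∈ interior (L '' effDom g - effDom f)) :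
    ∃ r : ℝ, (interior (boundedPerturbations g f L r)).Nonempty := by
  set V := interior (L '' effDom g - effDom f) with hV
  have hcover : ⋃ n : ℕ, (boundedPerturbations g f L n ∪ Vᶜ) = Set.univ := by
    refine Set.eq_univ_of_forall fun y => ?_
    rw [Set.mem_iUnion]
    by_cases hy : y ∈ V
    · obtain ⟨_, ⟨u, hu, rfl⟩, w, hw, rfl⟩ := interior_subset hy
      obtain ⟨a, ha⟩ := hg.exists_real hu
      obtain ⟨c, hc⟩ := hf.exists_real hw
      obtain ⟨n, hn⟩ := exists_nat_ge (max (max ‖u‖ ‖w‖) (max a c))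
      simp only [max_le_iff] at hn
      refine ⟨n, Or.inl ⟨u, w, hn.1.1, hn.1.2, ?_, ?_, rfl⟩⟩
      · rw [ha]; exact_mod_cast hn.2.1
      · rw [hc]; exact_mod_cast hn.2.2
    · exact ⟨0, Or.inr hy⟩
  have hdense := dense_iUnion_interior_of_closed (fun n : ℕ =>
    (isClosed_boundedPerturbations (L := L) hg hf n).union isOpen_interior.isClosed_compl) hcover
  obtain ⟨y, hyV, hy⟩ := hdense.inter_open_nonempty V isOpen_interior ⟨0, h0⟩
  obtain ⟨n, hn⟩ := Set.mem_iUnion.1 hy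
  refine ⟨n, y, mem_interior.2 ⟨V ∩ interior (boundedPerturbations g f L n ∪ Vᶜ), ?_,
    isOpen_interior.inter isOpen_interior, hyV, hn⟩⟩
  rintro z ⟨hzV, hz⟩
  exact (interior_subset hz).resolve_right fun h => h hzV

/-- Under the regularity condition every primal solution is part of a KKT pair. -/
lemma IsPrimalSolution.exists_isKKTPair (hg : ProperConvexLsc g) (hf : ProperConvexLsc f)
    (hreg : RegularityCondition g f L) {u : H₁} (hu : IsPrimalSolution g f L u) :
    ∃ c, IsKKTPair g f L u c := by
  have h0 := hreg.zero_mem_interior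
  have hu' : ∀ v, g u + f (L u) ≤ g v + f (L v) :=
    fun v => isMinOn_iff.1 hu v (Set.mem_univ v)
  have hfin : g u + f (L u) < ⊤ := by
    obtain ⟨_, ⟨v, hv, rfl⟩, w, hw, hvw⟩ := interior_subset h0
    obtain rfl := sub_eq_zero.1 hvw
    exact (hu' v).trans_lt (EReal.add_lt_top hv.ne hw.ne)
  have hgu : g u ≠ ⊤ := fun h => by
    rw [h, EReal.top_add_of_ne_bot (hf.ne_bot _)] at hfin
    exact lt_irrefl _ hfin
  have hfu : f (L u) ≠ ⊤ := fun h => by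
    rw [h, EReal.add_top_of_ne_bot (hg.ne_bot _)] at hfin
    exact lt_irrefl _ hfin
  obtain ⟨a, ha⟩ := hg.exists_real hgu.lt_top
  obtain ⟨c, hc⟩ := hf.exists_real hfu.lt_top
  set E := perturbationEpigraph g f L with hE
  have hEc : Convex ℝ E := convex_perturbationEpigraph hg hf
  have hEint : (interior E).Nonempty := by
    obtain ⟨r, y, hy⟩ := exists_interior_boundedPerturbations_nonempty hg hf h0
    refine ⟨(y, r + r + 1), mem_interior.2
      ⟨interior (boundedPerturbations g f L r) ×ˢ Set.Ioi (r + r), ?_,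
        isOpen_interior.prod isOpen_Ioi, hy, by simp⟩⟩
    rintro ⟨z, t⟩ ⟨hz, ht⟩
    obtain ⟨v, w, -, -, hv, hw, hvw⟩ := interior_subset hz
    exact ⟨v, w, r, r, hv, hw, hvw, (Set.mem_Ioi.1 ht).le⟩
  have hmin : ∀ t, ((0 : H₂), t) ∈ E → a + c ≤ t := by
    rintro t ⟨v, w, a', c', hv, hw, hvw, ht⟩
    obtain rfl := sub_eq_zero.1 hvw
    have h1 := (hu' v).trans (add_le_add hv hw)
    rw [ha, hc] at h1
    have h2 : a + c ≤ a' + c' := by exact_mod_cast h1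
    exact h2.trans ht
  have hnot : ((0 : H₂), a + c) ∉ interior E := by
    intro h
    have hcont : Tendsto (fun t : ℝ => ((0 : H₂), a + c - t)) (𝓝[>] 0) (𝓝 (0, a + c)) := by
      have : Continuous fun t : ℝ => ((0 : H₂), a + c - t) := by fun_prop
      simpa using (this.tendsto 0).mono_left nhdsWithin_le_nhds
    obtain ⟨t, ht, ht0⟩ := ((hcont.eventually (mem_interior_iff_mem_nhds.1 h)).and
      self_mem_nhdsWithin).exists
    have h1 := hmin _ ht
    have h2 : (0 : ℝ) < t := ht0
    linarith
  obtain ⟨φ, hφ⟩ := geometric_hahn_banach_open_point hEc.interior isOpen_interior hnot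
  -- Separation is only from the interior; a convex set with nonempty interior lies in the closure
  -- of it.
  have hφE : ∀ p ∈ E, φ p ≤ φ (0, a + c) := by
    intro p hp
    have hp' : p ∈ closure (interior E) := by
      rw [hEc.closure_interior_eq_closure_of_nonempty_interior hEint]
      exact subset_closure hp
    refine closure_minimal (t := {p | φ p ≤ φ (0, a + c)}) (fun q hq => (hφ q hq).le) ?_ hp'
    exact isClosed_le φ.continuous continuous_const
  set w : H₂ := (InnerProductSpace.toDual ℝ H₂).symm (φ.comp (ContinuousLinearMap.inl ℝ H₂ ℝ))
    with hw
  set s : ℝ := φ (0, 1) with hs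
  have hφ' : ∀ (z : H₂) (t : ℝ), φ (z, t) = inner ℝ w z + s * t := by
    intro z t
    have : ((z, t) : H₂ × ℝ) = (z, 0) + t • ((0, 1) : H₂ × ℝ) := by simp
    rw [this, map_add, map_smul, hw, InnerProductSpace.toDual_symm_apply]
    simp [hs, mul_comm]
  have hsep : ∀ v z (a' c' : ℝ), g v ≤ a' → f z ≤ c' →
      inner ℝ w (L v - z) + s * (a' + c') ≤ s * (a + c) := by
    intro v z a' c' hv hz
    have := hφE (L v - z, a' + c') ⟨v, z, a', c', hv, hz, rfl, le_rfl⟩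
    rwa [hφ', hφ', inner_zero_right, zero_add] at this
  have hs0 : s ≤ 0 := by
    have := hsep u (L u) (a + 1) c (ha.le.trans (by exact_mod_cast (by linarith))) hc.le
    rw [sub_self, inner_zero_right] at this
    linarith
  -- A vertical hyperplane would have `w` nonpositive on a neighbourhood of 0, hence `w = 0` and `φ
  -- = 0`, against strict separation.
  have hs1 : s ≠ 0 := by
    intro hs1
    have hle : ∀ y ∈ L '' effDom g - effDom f, inner ℝ w y ≤ 0 := by
      rintro _ ⟨_, ⟨v, hv, rfl⟩, z, hz, rfl⟩
      obtain ⟨a', ha'⟩ := hg.exists_real hv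
      obtain ⟨c', hc'⟩ := hf.exists_real hz
      simpa [hs1] using hsep v z a' c' ha'.le hc'.le
    have hw0 : w = 0 := by
      have hcont : Tendsto (fun t : ℝ => t • w) (𝓝[>] 0) (𝓝 0) := by
        have : Continuous fun t : ℝ => t • w := by fun_prop
        simpa using (this.tendsto 0).mono_left nhdsWithin_le_nhds
      obtain ⟨t, ht, ht0⟩ := ((hcont.eventually (mem_interior_iff_mem_nhds.1 h0)).and
        self_mem_nhdsWithin).exists
      have h1 := hle _ ht
      have h2 : (0 : ℝ) < t := ht0
      rw [real_inner_smul_right] at h1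
      have h3 : inner ℝ w w ≤ 0 := nonpos_of_mul_nonpos_right h1 h2
      exact inner_self_eq_zero.1 (le_antisymm h3 real_inner_self_nonneg)
    obtain ⟨⟨y, t⟩, hy⟩ := hEint
    have := hφ _ hy
    rw [hφ', hφ', hw0, hs1] at this
    simp at this
  have hs2 : s < 0 := lt_of_le_of_ne hs0 hs1
  have hsep' : ∀ v z (a' c' : ℝ), g v ≤ a' → f z ≤ c' →
      a + c ≤ inner ℝ (s⁻¹ • w) (L v - z) + (a' + c') := by
    intro v z a' c' hv hz
    have h1 := mul_le_mul_of_nonpos_left (hsep v z a' c' hv hz) (inv_lt_zero.2 hs2).le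
    rwa [inv_mul_cancel_left₀ hs1, mul_add, inv_mul_cancel_left₀ hs1,
      ← real_inner_smul_left] at h1
  -- Freezing `z = L u` gives the condition on `g`, freezing `v = u` the one on `f`.
  refine ⟨s⁻¹ • w, mem_subdiff_iff.2 ⟨a, ha, fun v a' hv => ?_⟩,
    mem_subdiff_iff.2 ⟨c, hc, fun z c' hz => ?_⟩⟩
  · have := hsep' v (L u) a' c hv hc.le
    rw [inner_neg_left, ContinuousLinearMap.adjoint_inner_left, map_sub]
    linarith
  · have := hsep' u z a c' ha.le hz
    rw [← neg_sub z, inner_neg_right] at this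
    linarith

lemma IsKKTPair.isPrimalSolution {u : H₁} {c : H₂} (h : IsKKTPair g f L u c)
    (hg : ProperConvexLsc g) (hf : ProperConvexLsc f) : IsPrimalSolution g f L u := by
  obtain ⟨a, ha, hga⟩ := mem_subdiff_iff.1 h.1
  obtain ⟨r, hr, hfr⟩ := mem_subdiff_iff.1 h.2
  refine isMinOn_iff.2 fun v _ => ?_
  rcases eq_or_ne (g v) ⊤ with hv | hv
  · rw [hv, EReal.top_add_of_ne_bot (hf.ne_bot _)]
    exact le_top
  rcases eq_or_ne (f (L v)) ⊤ with hv' | hv'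
  · rw [hv', EReal.add_top_of_ne_bot (hg.ne_bot _)]
    exact le_top
  obtain ⟨a', ha'⟩ := hg.exists_real hv.lt_top
  obtain ⟨r', hr'⟩ := hf.exists_real hv'.lt_top
  have h1 := hga v a' ha'.le
  have h2 := hfr (L v) r' hr'.le
  rw [inner_neg_left, ContinuousLinearMap.adjoint_inner_left, map_sub] at h1
  rw [ha, hr, ha', hr']
  exact_mod_cast (by linarith : a + r ≤ a' + r')

/-- The pairings with `u` and `L u` cancel in the two Fenchel–Young inequalities, so every dual
objective value is at least minus the primal one, with equality at `c`. -/
lemma IsKKTPair.isDualSolution {u : H₁} {c : H₂} (h : IsKKTPair g f L u c)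
    (hg : ProperConvexLsc g) (hf : ProperConvexLsc f) : IsDualSolution g f L c := by
  obtain ⟨a, ha, -⟩ := mem_subdiff_iff.1 h.1
  obtain ⟨r, hr, -⟩ := mem_subdiff_iff.1 h.2
  refine isMinOn_iff.2 fun c' _ => ?_
  have h1 := coe_le_conj (y := -(ContinuousLinearMap.adjoint L c')) ha.le
  have h2 := coe_le_conj (y := c') hr.le
  refine le_trans ?_ (add_le_add h1 h2)
  rw [conjNegAdjoint, conj_eq_of_mem_subdiff hg.ne_bot h.1 ha,
    conj_eq_of_mem_subdiff hf.ne_bot h.2 hr, ← EReal.coe_add, ← EReal.coe_add,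
    EReal.coe_le_coe_iff]
  simp only [inner_neg_right, ContinuousLinearMap.adjoint_inner_right]
  linarith

lemma properConvexLsc_conjNegAdjoint (hg : ProperConvexLsc g)
    (hdom : (effDom (conjNegAdjoint g L)).Nonempty) : ProperConvexLsc (conjNegAdjoint g L) where
  ne_bot b := conj_ne_bot hg _
  dom_nonempty := hdom
  convex_epigraph := by
    have := (convex_epigraph_conj hg.ne_bot).linear_preimage
      (((-(ContinuousLinearMap.adjoint L)).toLinearMap).prodMap (LinearMap.id (R := ℝ) (M := ℝ)))
    exact this
  lsc := (lowerSemicontinuous_conj hg.ne_bot).comp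
    (-(ContinuousLinearMap.adjoint L)).continuous

/-- The easy inclusion in the chain rule, a consequence of Fenchel–Young alone. -/
lemma neg_apply_mem_subdiff_conjNegAdjoint (hg : ProperConvexLsc g) {u : H₁} {p : H₂}
    (h : -(ContinuousLinearMap.adjoint L p) ∈ subdiff g u) :
    -(L u) ∈ subdiff (conjNegAdjoint g L) p := by
  obtain ⟨a, ha, -⟩ := mem_subdiff_iff.1 h
  refine mem_subdiff_iff.2 ⟨_, conj_eq_of_mem_subdiff hg.ne_bot h ha, fun z c hc => ?_⟩
  have := (conj_le_coe_iff hg.ne_bot).1 hc u a ha.le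
  simp only [inner_neg_right, inner_neg_left, ContinuousLinearMap.adjoint_inner_right,
    inner_sub_right] at this ⊢
  linarith

/-- The chain rule turns a subgradient of `g^* ∘ (-L^*)` into a KKT pair. -/
lemma SubdiffChainRule.exists_isKKTPair (hchain : SubdiffChainRule g L) (hg : ProperConvexLsc g)
    {c d : H₂} (hc : -d ∈ subdiff (conjNegAdjoint g L) c) (hd : c ∈ subdiff f d) :
    ∃ u, L u = d ∧ IsKKTPair g f L u c := by
  rw [hchain c, Set.neg_mem_neg] at hc
  obtain ⟨u, hu, rfl⟩ := hc
  exact ⟨u, rfl, mem_subdiff_of_mem_subdiff_conj hg hu, hd⟩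

end Duality

/-! ### Exact Douglas–Rachford steps and limits of graphs -/

section DouglasRachford

variable {ι H : Type*} [NormedAddCommGroup H] [InnerProductSpace ℝ H]

/-- One exact Douglas-Rachford step is Fejér monotone in the primal-dual pair. -/
lemma norm_sq_add_norm_sq_le_of_inner_nonpos {b d y b' d' bs ds : H} (hsum : b' + d' = b + y)
    (h₁ : inner ℝ (b + y - d - bs) (y - ds) ≤ 0) (h₂ : 0 ≤ inner ℝ (b' - bs) (d' - ds)) :
    ‖b' - bs‖ ^ 2 + ‖d' - ds‖ ^ 2 + ‖y - d‖ ^ 2 ≤ ‖b - bs‖ ^ 2 + ‖d - ds‖ ^ 2 := by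
  have e₁ : b + y - d - bs = (b - bs) + (y - ds) - (d - ds) := by abel
  have e₂ : y - d = (y - ds) - (d - ds) := by abel
  -- After expansion, `h₂` discards the cross term on the left and `h₁` controls the one on the
  -- right.
  have e₃ : ‖(b' - bs) + (d' - ds)‖ ^ 2 = ‖(b - bs) + (y - ds)‖ ^ 2 := by
    rw [show (b' - bs) + (d' - ds) = (b' + d') - (bs + ds) by abel, hsum,
      show (b - bs) + (y - ds) = (b + y) - (bs + ds) by abel]
  rw [e₁, inner_sub_left, inner_add_left, real_inner_self_eq_norm_sq] at h₁
  rw [norm_add_sq_real, norm_add_sq_real] at e₃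
  rw [e₂, norm_sub_sq_real (y - ds), real_inner_comm (d - ds)]
  linarith

/-- If two graphs of subdifferentials are approximated asymptotically by the same weakly
convergent sequence of pairs, the weak limit belongs to both graphs. -/
lemma mem_subdiff_of_weakLim_of_sub_tendsto_zero [CompleteSpace H] {F G : H → EReal}
    (hF : ProperConvexLsc F) (hG : ProperConvexLsc G) {U : Ultrafilter ι}
    {b d x y p z : ι → H} {bhat dhat : H} {C : ℝ}
    (hb : WeakLim (U : Filter ι) b bhat) (hd : WeakLim (U : Filter ι) d dhat)
    (hbC : ∀ k, ‖b k‖ ≤ C) (hdC : ∀ k, ‖d k‖ ≤ C)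
    (hy : ∀ k, y k ∈ subdiff F (x k)) (hz : ∀ k, -z k ∈ subdiff G (p k))
    (hxd : Tendsto (fun k => x k - d k) U (𝓝 0)) (hyb : Tendsto (fun k => y k - b k) U (𝓝 0))
    (hpb : Tendsto (fun k => p k - b k) U (𝓝 0)) (hzd : Tendsto (fun k => z k - d k) U (𝓝 0)) :
    bhat ∈ subdiff F dhat ∧ -dhat ∈ subdiff G bhat := by
  obtain ⟨r, hr⟩ : ∃ r : ℝ, Tendsto (fun k => inner ℝ (b k) (d k)) U (𝓝 r) := by
    obtain ⟨r, hr⟩ := exists_weakLim_of_bounded U (x := fun k => (inner ℝ (b k) (d k) : ℝ))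
      (C := C * C) fun k => (norm_inner_le_norm _ _).trans
        (mul_le_mul (hbC k) (hdC k) (norm_nonneg _) ((norm_nonneg _).trans (hbC k)))
    exact ⟨r, by simpa using hr 1⟩
  have hF' : Tendsto (fun k => inner ℝ (y k) (x k)) U (𝓝 r) := by
    simpa using (tendsto_inner_sub_inner_zero hyb hxd hbC hdC).add hr
  have hG' : Tendsto (fun k => inner ℝ (-z k) (p k)) U (𝓝 (-r)) := by
    have := (tendsto_inner_sub_inner_zero hpb hzd hbC hdC).add hr
    simp only [sub_add_cancel, zero_add] at this
    simpa only [inner_neg_left, real_inner_comm] using this.neg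
  -- The pairings tend to `r` and `-r`, so the two limit inequalities bound `r` from both sides and
  -- each supplies the reverse bound the other needs.
  obtain ⟨h₁, h₁'⟩ := WeakLim.subdiff_limit hF (hd.of_sub_tendsto_zero hxd)
    (hb.of_sub_tendsto_zero hyb) hF' hy
  obtain ⟨h₂, h₂'⟩ := WeakLim.subdiff_limit hG (hb.of_sub_tendsto_zero hpb)
    (hd.of_sub_tendsto_zero hzd).neg hG' hz
  rw [inner_neg_left, real_inner_comm] at h₂ h₂'
  exact ⟨h₁' (by linarith), h₂' (by linarith)⟩

lemma norm_toLp_pair_le {E : Type*} [SeminormedAddCommGroup E] {x y : E} {r : ℝ}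
    (hx : ‖x‖ ≤ r) (hy : ‖y‖ ≤ r) : ‖WithLp.toLp 2 (x, y)‖ ≤ 2 * r := by
  have hr := (norm_nonneg x).trans hx
  refine le_of_sq_le_sq ?_ (by positivity)
  rw [WithLp.prod_norm_sq_eq_of_L2]
  have h₁ : ‖x‖ ^ 2 ≤ r ^ 2 := by gcongr
  have h₂ : ‖y‖ ^ 2 ≤ r ^ 2 := by gcongr
  have h₃ : ‖x‖ ^ 2 + ‖y‖ ^ 2 ≤ (2 * r) ^ 2 := by nlinarith
  exact h₃

lemma weakLim_fst_of_weakLim_toLp {l : Filter ι} {x y : ι → H} {a : WithLp 2 (H × H)}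
    (h : WeakLim l (fun k => WithLp.toLp 2 (x k, y k)) a) : WeakLim l x a.fst := fun v => by
  simpa [WithLp.prod_inner_apply] using h (WithLp.toLp 2 (v, 0))

lemma weakLim_snd_of_weakLim_toLp {l : Filter ι} {x y : ι → H} {a : WithLp 2 (H × H)}
    (h : WeakLim l (fun k => WithLp.toLp 2 (x k, y k)) a) : WeakLim l y a.snd := fun v => by
  simpa [WithLp.prod_inner_apply] using h (WithLp.toLp 2 (0, v))

end DouglasRachford

/-! ### Optimality conditions of the minimization steps -/

section ProximalStep

variable {H₁ H₂ : Type*} [NormedAddCommGroup H₁] [InnerProductSpace ℝ H₁]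
  [NormedAddCommGroup H₂] [InnerProductSpace ℝ H₂]
  {f : H₂ → EReal} {L : H₁ →L[ℝ] H₂} {lam : ℝ}

lemma smul_mem_subdiff_of_isMinOn_functional₂ (hf : ProperConvexLsc f) {b d : H₂} {u : H₁}
    (h : IsMinOn (functional₂ f L lam b u) Set.univ d) :
    lam • (b + L u - d) ∈ subdiff f d := by
  refine mem_subdiff_of_isMinOn_add_norm_sq hf (lam := lam) (-ContinuousLinearMap.id ℝ H₂)
    (b + L u) ?_ fun z => ?_
  · convert h using 3 with v
    simp [functional₂, sub_eq_add_neg]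
  · rw [real_inner_smul_left]
    simp [sub_eq_add_neg]

end ProximalStep

/-! ### Convergence of the inexact algorithm -/

section Convergence

variable {H₁ H₂ : Type*}
  [NormedAddCommGroup H₁] [InnerProductSpace ℝ H₁] [CompleteSpace H₁]
  [NormedAddCommGroup H₂] [InnerProductSpace ℝ H₂] [CompleteSpace H₂]
  {g : H₁ → EReal} {f : H₂ → EReal} {L : H₁ →L[ℝ] H₂} {lam : ℝ}

lemma neg_adjoint_mem_subdiff_of_isMinOn_functional₁ (hg : ProperConvexLsc g) {b d : H₂} {u : H₁}
    (h : IsMinOn (functional₁ g L lam b d) Set.univ u) :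
    -(ContinuousLinearMap.adjoint L (lam • (b + L u - d))) ∈ subdiff g u := by
  refine mem_subdiff_of_isMinOn_add_norm_sq hg (lam := lam) L (b - d) ?_ fun z => ?_
  · convert h using 3 with v
    simp only [functional₁, sub_add_eq_add_sub]
  · rw [inner_neg_left, ContinuousLinearMap.adjoint_inner_left, real_inner_smul_left,
      sub_add_eq_add_sub]

/-- The points `(bs, ds)` for which `lam • bs` is a multiplier of a primal solution over `ds`. -/
def scaledKKTSet (g : H₁ → EReal) (f : H₂ → EReal) (L : H₁ →L[ℝ] H₂) (lam : ℝ) :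
    Set (WithLp 2 (H₂ × H₂)) :=
  {s | ∃ u, L u = s.snd ∧ IsKKTPair g f L u (lam • s.fst)}

/-- The quasi-Fejér estimate for one step of the inexact algorithm. -/
lemma norm_sq_step_le (hlam : 0 < lam) {s : WithLp 2 (H₂ × H₂)}
    (hs : s ∈ scaledKKTSet g f L lam) {b d b' d' dex : H₂} {u uex : H₁} {α β : ℝ}
    (hu : -(ContinuousLinearMap.adjoint L (lam • (b + L uex - d))) ∈ subdiff g uex)
    (hα : ‖L u - L uex‖ ≤ α) (hd : lam • (b + L u - dex) ∈ subdiff f dex) (hβ : ‖d' - dex‖ ≤ β)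
    (hb : b' = b + L u - d') :
    ‖WithLp.toLp 2 (b', d') - s‖ ^ 2 + ‖L uex - (d + (L u - L uex))‖ ^ 2 ≤
      (‖WithLp.toLp 2 (b, d) - s‖ + 2 * (α + β)) ^ 2 := by
  obtain ⟨us, hus, hs₁, hs₂⟩ := hs
  set e := L u - L uex with he
  set bs := s.fst
  set ds := s.snd
  have m₁ := inner_sub_sub_nonneg_of_mem_subdiff hu hs₁
  have m₂ := inner_sub_sub_nonneg_of_mem_subdiff hd hs₂
  rw [← neg_sub_neg, neg_neg, neg_neg, ← map_sub, ContinuousLinearMap.adjoint_inner_left,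
    ← smul_sub, map_sub, real_inner_smul_left, hus, ← neg_sub, inner_neg_left] at m₁
  rw [← smul_sub, real_inner_smul_left, hus] at m₂
  have h₂ := nonneg_of_mul_nonneg_right m₂ hlam
  have h₁ : inner ℝ (b + L uex - d - bs) (L uex - ds) ≤ 0 :=
    neg_nonneg.1 (nonneg_of_mul_nonneg_right m₁ hlam)
  -- The error `e` is absorbed by shifting both components of the state: `b - d` is unchanged, while
  -- `b + e + L uex = b + L u`. The step is then exact.
  have hstep := norm_sq_add_norm_sq_le_of_inner_nonpos (b := b + e) (d := d + e) (y := L uex)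
    (b' := b + L u - dex) (d' := dex) (bs := bs) (ds := ds) (by rw [he]; abel)
    (by rwa [show b + e + L uex - (d + e) - bs = b + L uex - d - bs by abel]) h₂
  have hn : ∀ x y : H₂, ‖WithLp.toLp 2 (x, y) - s‖ ^ 2 = ‖x - bs‖ ^ 2 + ‖y - ds‖ ^ 2 :=
    fun x y => WithLp.prod_norm_sq_eq_of_L2 _
  rw [← hn, ← hn] at hstep
  have t₁ : ‖WithLp.toLp 2 (b + e, d + e) - s‖ ≤ ‖WithLp.toLp 2 (b, d) - s‖ + 2 * α := by
    rw [show WithLp.toLp 2 (b + e, d + e) - s =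
      (WithLp.toLp 2 (b, d) - s) + WithLp.toLp 2 (e, e) by
        rw [← Prod.mk_add_mk, WithLp.toLp_add]; abel]
    exact (norm_add_le _ _).trans (by gcongr; exact norm_toLp_pair_le hα hα)
  have t₂ : ‖WithLp.toLp 2 (b', d') - s‖ ≤ ‖WithLp.toLp 2 (b + L u - dex, dex) - s‖ + 2 * β := by
    rw [show WithLp.toLp 2 (b', d') - s = (WithLp.toLp 2 (b + L u - dex, dex) - s) +
      WithLp.toLp 2 (dex - d', d' - dex) by
        rw [sub_add_eq_add_sub, ← WithLp.toLp_add, Prod.mk_add_mk, hb]; congr 3 <;> abel]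
    exact (norm_add_le _ _).trans (by
      gcongr; exact norm_toLp_pair_le (by rwa [norm_sub_rev]) hβ)
  have hα0 := (norm_nonneg _).trans hα
  have hβ0 := (norm_nonneg _).trans hβ
  set N := ‖WithLp.toLp 2 (b, d) - s‖
  set N' := ‖WithLp.toLp 2 (b', d') - s‖
  set Ne := ‖WithLp.toLp 2 (b + e, d + e) - s‖
  set Nx := ‖WithLp.toLp 2 (b + L u - dex, dex) - s‖
  set r := ‖L uex - (d + e)‖
  have hN : 0 ≤ N := norm_nonneg _
  have hN' : 0 ≤ N' := norm_nonneg _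
  have hNe : 0 ≤ Ne := norm_nonneg _
  have hNx : 0 ≤ Nx := norm_nonneg _
  have hNxe : Nx ≤ Ne := le_of_sq_le_sq (by linarith [sq_nonneg r]) hNe
  have q₁ : N' ^ 2 ≤ (Nx + 2 * β) ^ 2 := by gcongr
  have q₂ : (Ne + 2 * β) ^ 2 ≤ (N + 2 * (α + β)) ^ 2 := by
    refine pow_le_pow_left₀ (by positivity) ?_ 2
    linarith
  -- The cross term 4βNx is at most 4βNe, so `r²` survives the passage from `Nx` to `N'`.
  nlinarith [mul_le_mul_of_nonneg_left hNxe hβ0]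

/-- Convergence of the primal-dual sequence and of its residuals. -/
lemma IsApproxSplitBregman.exists_weakLim (hlam : 0 < lam) (hg : ProperConvexLsc g)
    (hf : ProperConvexLsc f) (hchain : SubdiffChainRule g L)
    (hS : (scaledKKTSet g f L lam).Nonempty) {α β : ℕ → ℝ}
    (hsum : Summable fun k => α (k + 1) + β (k + 1)) {u : ℕ → H₁} {d b : ℕ → H₂}
    (halg : IsApproxSplitBregman g f L lam α β u d b) :
    (∃ s ∈ scaledKKTSet g f L lam, WeakLim atTop b s.fst ∧ WeakLim atTop d s.snd) ∧
      Summable fun k => ‖d k - L (u (k + 1))‖ ^ 2 := by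
  choose uex huex hα using halg.step_u
  choose dex hdex hβ using halg.step_d
  have hα0 : ∀ k, 0 ≤ α (k + 1) := fun k => (norm_nonneg _).trans (hα k)
  have hβ0 : ∀ k, 0 ≤ β (k + 1) := fun k => (norm_nonneg _).trans (hβ k)
  have hαs : Summable fun k => α (k + 1) :=
    hsum.of_nonneg_of_le hα0 fun k => le_add_of_nonneg_right (hβ0 k)
  have hβs : Summable fun k => β (k + 1) :=
    hsum.of_nonneg_of_le hβ0 fun k => le_add_of_nonneg_left (hα0 k)
  have hgu := fun k => neg_adjoint_mem_subdiff_of_isMinOn_functional₁ hg (huex k)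
  have hfd := fun k => smul_mem_subdiff_of_isMinOn_functional₂ hf (hdex k)
  have hfejer : ∀ s ∈ scaledKKTSet g f L lam,
      (∃ a, Tendsto (fun k => ‖WithLp.toLp 2 (b k, d k) - s‖) atTop (𝓝 a)) ∧
      Summable fun k => ‖L (uex k) - (d k + (L (u (k + 1)) - L (uex k)))‖ ^ 2 := fun s hs =>
    quasiFejer (ε := fun k => 2 * (α (k + 1) + β (k + 1))) (fun k => norm_nonneg _)
      (hsum.mul_left 2) (fun k => mul_nonneg zero_le_two (add_nonneg (hα0 k) (hβ0 k)))
      fun k => norm_sq_step_le hlam hs (hgu k) (hα k) (hfd k) (hβ k) (halg.step_b k)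
  obtain ⟨s₀, hs₀⟩ := hS
  obtain ⟨⟨a₀, ha₀⟩, hr⟩ := hfejer s₀ hs₀
  have he0 : Tendsto (fun k => L (u (k + 1)) - L (uex k)) atTop (𝓝 0) :=
    squeeze_zero_norm hα hαs.tendsto_atTop_zero
  have hdd : Tendsto (fun k => d (k + 1) - dex k) atTop (𝓝 0) :=
    squeeze_zero_norm hβ hβs.tendsto_atTop_zero
  -- This residual differs from the Fejér one by sign and 2e; (r + 2α)² ≤ 2r² + 8α², and α² is at
  -- most α times the total sum.
  have hres : Summable fun k => ‖d k - L (u (k + 1))‖ ^ 2 := by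
    have hT : ∀ k, α (k + 1) ≤ ∑' i, α (i + 1) := fun k => hαs.le_tsum k fun i _ => hα0 i
    refine ((hr.mul_left 2).add (hαs.mul_left (8 * ∑' i, α (i + 1)))).of_nonneg_of_le
      (fun k => sq_nonneg _) fun k => ?_
    set e := L (u (k + 1)) - L (uex k) with he
    have h₁ : ‖d k - L (u (k + 1))‖ ≤ ‖L (uex k) - (d k + e)‖ + 2 * α (k + 1) := by
      have h₂ : d k - L (u (k + 1)) = -(L (uex k) - (d k + e)) - (e + e) := by rw [he]; abel
      rw [h₂]
      refine (norm_sub_le _ _).trans ?_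
      rw [norm_neg]
      gcongr
      refine (norm_add_le _ _).trans ?_
      linarith [hα k]
    have h₃ : ‖d k - L (u (k + 1))‖ ^ 2 ≤ (‖L (uex k) - (d k + e)‖ + 2 * α (k + 1)) ^ 2 := by
      gcongr
    nlinarith [sq_nonneg (‖L (uex k) - (d k + e)‖ - 2 * α (k + 1)),
      mul_le_mul_of_nonneg_right (hT k) (hα0 k)]
  have hyd : Tendsto (fun k => L (uex k) - d k) atTop (𝓝 0) := by
    have h₁ : Tendsto (fun k => L (uex k) - (d k + (L (u (k + 1)) - L (uex k)))) atTop (𝓝 0) := by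
      rw [tendsto_zero_iff_norm_tendsto_zero]
      simpa using hr.tendsto_atTop_zero.sqrt
    simpa [sub_add_eq_sub_sub] using h₁.add he0
  refine ⟨?_, hres⟩
  have hbdd : ∃ C, ∀ k, ‖WithLp.toLp 2 (b k, d k)‖ ≤ C := by
    obtain ⟨C, hC⟩ := ha₀.bddAbove_range
    refine ⟨C + ‖s₀‖, fun k => ?_⟩
    have h₁ : ‖WithLp.toLp 2 (b k, d k) - s₀‖ ≤ C := hC ⟨k, rfl⟩
    have h₂ := norm_add_le (WithLp.toLp 2 (b k, d k) - s₀) s₀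
    rw [sub_add_cancel] at h₂
    linarith
  obtain ⟨C, hC⟩ := hbdd
  have hbC : ∀ k, ‖b k‖ ≤ C := fun k =>
    (WithLp.norm_fst_le _ (WithLp.toLp 2 (b k, d k))).trans (hC k)
  have hdC : ∀ k, ‖d k‖ ≤ C := fun k =>
    (WithLp.norm_snd_le _ (WithLp.toLp 2 (b k, d k))).trans (hC k)
  have hG : ProperConvexLsc (conjNegAdjoint g L) :=
    properConvexLsc_conjNegAdjoint hg ⟨lam • (b 0 + L (uex 0) - d 0),
      (neg_apply_mem_subdiff_conjNegAdjoint hg (hgu 0)).2.1.lt_top⟩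
  -- The shift is needed because `b 0, d 0` are arbitrary: at `k + 1` the inclusion for `f` comes
  -- from the step producing the pair, the one for `g` from the step starting there.
  obtain ⟨s, hs, hlim⟩ := exists_weakLim_of_tendsto_norm_sub
    (x := fun k => WithLp.toLp 2 (b (k + 1), d (k + 1))) (S := scaledKKTSet g f L lam)
    ⟨C, fun k => hC (k + 1)⟩
    (fun s hs => ⟨_, (hfejer s hs).1.choose_spec.comp (tendsto_add_atTop_nat 1)⟩) (by
      intro U a hU ha
      have hb := (weakLim_fst_of_weakLim_toLp ha).const_smul lam
      have hd := weakLim_snd_of_weakLim_toLp ha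
      have hxd : Tendsto (fun k => dex k - d (k + 1)) U (𝓝 0) := by
        simpa using (hdd.mono_left hU).neg
      have hyd' : Tendsto (fun k => L (uex (k + 1)) - d (k + 1)) U (𝓝 0) :=
        (hyd.comp (tendsto_add_atTop_nat 1)).mono_left hU
      obtain ⟨h₁, h₂⟩ := mem_subdiff_of_weakLim_of_sub_tendsto_zero (C := max (lam * C) C)
        hf hG hb hd
        (fun k => by
          rw [norm_smul, Real.norm_of_nonneg hlam.le]
          exact (mul_le_mul_of_nonneg_left (hbC _) hlam.le).trans (le_max_left _ _))
        (fun k => (hdC _).trans (le_max_right _ _)) hfd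
        (fun k => neg_apply_mem_subdiff_conjNegAdjoint hg (hgu (k + 1))) hxd
        (by
          have : ∀ k, lam • (b k + L (u (k + 1)) - dex k) - lam • b (k + 1) =
              lam • (d (k + 1) - dex k) := fun k => by
            rw [← smul_sub, halg.step_b k]; congr 1; abel
          simp only [this]
          simpa using (hdd.mono_left hU).const_smul lam)
        (by
          have : ∀ k, lam • (b (k + 1) + L (uex (k + 1)) - d (k + 1)) - lam • b (k + 1) =
              lam • (L (uex (k + 1)) - d (k + 1)) := fun k => by
            rw [← smul_sub]; congr 1; abel
          simp only [this]
          simpa using hyd'.const_smul lam)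
        hyd'
      exact hchain.exists_isKKTPair hg h₂ h₁)
  refine ⟨s, hs, fun v => ?_, fun v => ?_⟩
  · exact (tendsto_add_atTop_iff_nat 1).1 (weakLim_fst_of_weakLim_toLp hlim v)
  · exact (tendsto_add_atTop_iff_nat 1).1 (weakLim_snd_of_weakLim_toLp hlim v)

end Convergence

end SplitBregman

theorem theorem3p2 {H₁ H₂ : Type*}
    [NormedAddCommGroup H₁] [InnerProductSpace ℝ H₁] [CompleteSpace H₁]
    [NormedAddCommGroup H₂] [InnerProductSpace ℝ H₂] [CompleteSpace H₂]
    (g : H₁ → EReal) (f : H₂ → EReal) (L : H₁ →L[ℝ] H₂) (lam : ℝ) (hlam : 0 < lam)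
    (hg : SplitBregman.ProperConvexLsc g) (hf : SplitBregman.ProperConvexLsc f)
    (hreg : SplitBregman.RegularityCondition g f L)
    (hP : ∃ u, SplitBregman.IsPrimalSolution g f L u)
    (hD : ∃ b, SplitBregman.IsDualSolution g f L b)
    (hchain : SplitBregman.SubdiffChainRule g L)
    (α β : ℕ → ℝ) (hsum : Summable (fun k : ℕ => α (k + 1) + β (k + 1)))
    (u : ℕ → H₁) (d b : ℕ → H₂)
    (halg : SplitBregman.IsApproxSplitBregman g f L lam α β u d b) :
    ∃ dhat bhat : H₂,
      SplitBregman.WeakTendsto d dhat ∧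
      SplitBregman.WeakTendsto b bhat ∧
      SplitBregman.IsDualSolution g f L (lam • bhat) ∧
      Tendsto (fun k => d k - L (u (k + 1))) atTop (𝓝 0) ∧
      Summable (fun k => ‖d k - L (u (k + 1))‖ ^ 2) ∧
      ∃ uhat : H₁, L uhat = dhat ∧ SplitBregman.IsPrimalSolution g f L uhat ∧
        (Function.Injective L → ∀ ubar, SplitBregman.WeakClusterPt u ubar → ubar = uhat) := by
  obtain ⟨us, hus⟩ := hP
  obtain ⟨c, hc⟩ := hus.exists_isKKTPair hg hf hreg
  have hS : (SplitBregman.scaledKKTSet g f L lam).Nonempty := by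
    refine ⟨WithLp.toLp 2 (lam⁻¹ • c, L us), us, rfl, ?_⟩
    simpa [smul_smul, mul_inv_cancel₀ hlam.ne'] using hc
  obtain ⟨⟨s, ⟨uhat, huhat, hkkt⟩, hb, hd⟩, hres⟩ :=
    halg.exists_weakLim hlam hg hf hchain hS hsum
  have hres0 : Tendsto (fun k => d k - L (u (k + 1))) atTop (𝓝 0) := by
    rw [tendsto_zero_iff_norm_tendsto_zero]
    simpa using hres.tendsto_atTop_zero.sqrt
  refine ⟨s.snd, s.fst, SplitBregman.tendsto_toWeakSpace_iff.2 hd,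
    SplitBregman.tendsto_toWeakSpace_iff.2 hb, hkkt.isDualSolution hg hf, hres0, hres, uhat, huhat,
    hkkt.isPrimalSolution hg hf, fun hinj ubar hubar => hinj ?_⟩
  obtain ⟨U, hU, hlim⟩ := mapClusterPt_iff_ultrafilter.1 hubar
  -- Although `u` itself need not converge, its image under `L` does, since `d k - L (u (k + 1))`
  -- tends to 0; this fixes the image of every weak cluster point.
  have hLu : SplitBregman.WeakLim atTop (fun k => L (u k)) s.snd := by
    have h : SplitBregman.WeakLim atTop (fun k => L (u (k + 1))) s.snd :=
      hd.of_sub_tendsto_zero (by simpa using hres0.neg)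
    exact fun v => (tendsto_add_atTop_iff_nat 1).1 (h v)
  rw [huhat]
  exact ((SplitBregman.tendsto_toWeakSpace_iff.1 hlim).map L).unique (hLu.mono hU)
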